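/- Let $N\ge 1$ and let $M$ be an $N\times N$ matrix from the Gaussian unitary ensemble (GUE) with density proportional to $e^{-\frac N2\operatorname{Tr}M^2}$ on Hermitian matrices; that is, $M$ is Hermitian, its entries on and above the diagonal are independent and centred, the diagonal entries are real Gaussian of variance $\frac1N$, and the entries above the diagonal are complex Gaussian whose real and imaginary parts are independent of variance $\frac1{2N}$. Let $\mathbb{E}^{(H)}_N$ denote the expectation. Define the secular coefficients of $M$ by $$\det(t-M)=\sum_{j=0}^N(-1)^j\,\mathrm{Sc}_j(M)\,t^{N-j},$$ and $\mathrm{Sc}_j(M)=0$ for $j>N$. Let $H_n$ be the monic Hermite polynomials, orthogonal with respect to $e^{-x^2/2}$ on $\mathbb{R}$, and $h_n(x)=N^{-n/2}H_n(\sqrt N\,x)$. Then all the random variables below are integrable, and the following hold. (i) First moments: $\mathbb{E}^{(H)}_N[\mathrm{Sc}_r(M)]=0$ for every odd $r\ge 0$, and for every even $r$ with $0\le r\le N$ $$\mathbb{E}^{(H)}_N[\mathrm{Sc}_r(M)]=(-1)^{r/2}\,\frac{N!}{(2N)^{r/2}\,(r/2)!\,(N-r)!}.$$ (ii) For every $t\in\mathbb{C}$,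 $$\mathbb{E}^{(H)}_N[\det(t-M)]=\sum_{j=0}^{\lfloor N/2\rfloor}\mathbb{E}^{(H)}_N[\mathrm{Sc}_{2j}(M)]\,t^{N-2j}=h_N(t).$$ (iii) For all integers $j,k\ge 0$, $\mathbb{E}^{(H)}_N[\mathrm{Sc}_{2j}(M)\,\mathrm{Sc}_{2k+1}(M)]=0$. (iv) For all integers $r,s\ge 0$ with $2r\le N$ and $2s\le N$, $$\mathbb{E}^{(H)}_N[\mathrm{Sc}_{2r}(M)\,\mathrm{Sc}_{2s}(M)]=\left(-\frac1{2N}\right)^{r+s}\sum_{j=0}^{\min(r,s)}\frac{2^{2j}}{(r-j)!\,(s-j)!}\,\frac{N!\,(N-2j)!}{(N-2r)!\,(N-2s)!}.$$ (v) For all integers $r,s\ge 0$ with $2r+1\le N$ and $2s+1\le N$, $$\mathbb{E}^{(H)}_N[\mathrm{Sc}_{2r+1}(M)\,\mathrm{Sc}_{2s+1}(M)]=\left(-\frac1{2N}\right)^{r+s}\sum_{j=0}^{\min(r,s)}\frac{2^{2j}}{(r-j)!\,(s-j)!}\,\frac{(N-1)!\,(N-2j-1)!}{(N-2r-1)!\,(N-2s-1)!}.$$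 -/

import Mathlib

open MeasureTheory ProbabilityTheory

noncomputable section

/-- The Hermitian `N × N` matrix built from `N²` real numbers `g i j`: real diagonal entries
`g i i / √N`, and entries `(g i j + i g j i) / √(2N)` above the diagonal. -/
def gueMatrix (N : ℕ) (g : Fin N → Fin N → ℝ) : Matrix (Fin N) (Fin N) ℂ :=
  Matrix.of fun i j =>
    if i = j then ((g i i / √(N : ℝ) : ℝ) : ℂ)
    else if i < j then ((g i j : ℂ) + Complex.I * (g j i : ℂ)) / ((√(2 * N : ℝ) : ℝ) : ℂ)
    else ((g j i : ℂ) - Complex.I * (g i j : ℂ)) / ((√(2 * N : ℝ) : ℝ) : ℂ)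

theorem gueMatrix_isHermitian (N : ℕ) (g : Fin N → Fin N → ℝ) :
    (gueMatrix N g).IsHermitian := by
  ext i j
  rcases lt_trichotomy i j with h | h | h
  · simp [gueMatrix, Matrix.conjTranspose_apply, h, h.ne, h.ne', h.not_gt]
  · subst h
    simp [gueMatrix, Matrix.conjTranspose_apply, -Complex.ofReal_div]
  · simp [gueMatrix, Matrix.conjTranspose_apply, h, h.ne, h.ne', h.not_gt, sub_eq_add_neg]

/-- Matrices carry the product σ-algebra of their entries. -/
instance instMeasurableSpaceMatrixFin (N : ℕ) : MeasurableSpace (Matrix (Fin N) (Fin N) ℂ) :=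
  inferInstanceAs (MeasurableSpace (Fin N → Fin N → ℂ))

/-- The law of the `N × N` Gaussian unitary ensemble with density proportional to
`exp (-(N/2) Tr M²)` on Hermitian matrices: the entries on and above the diagonal are independent
and centred, the diagonal ones real Gaussian of variance `1/N`, the others complex Gaussian whose
real and imaginary parts are independent of variance `1/(2N)`. -/
def gueMeasure (N : ℕ) : Measure (Matrix (Fin N) (Fin N) ℂ) :=
  (Measure.pi fun _ : Fin N => Measure.pi fun _ : Fin N => gaussianReal 0 1).map (gueMatrix N)

theorem measurable_gueMatrix (N : ℕ) : Measurable (gueMatrix N) := by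
  refine measurable_pi_lambda _ fun i => measurable_pi_lambda _ fun j => ?_
  simp only [gueMatrix, Matrix.of_apply]
  split_ifs <;> fun_prop

instance isProbabilityMeasure_gueMeasure (N : ℕ) : IsProbabilityMeasure (gueMeasure N) :=
  Measure.isProbabilityMeasure_map (measurable_gueMatrix N).aemeasurable

/-- The `r`-th secular coefficient of an `N × N` matrix `M`, i.e. `(-1)^r` times the coefficient
of `t^(N-r)` in `det (t - M)` for `r ≤ N`, and `0` for `r > N`. -/
def secular {N : ℕ} (r : ℕ) (M : Matrix (Fin N) (Fin N) ℂ) : ℂ :=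
  if r ≤ N then (-1) ^ r * M.charpoly.coeff (N - r) else 0

/-- The secular coefficients are determined by `det (t - M) = ∑_j (-1)^j Sc_j(M) t^(N-j)`. -/
theorem det_sub_eq_sum_secular {N : ℕ} (M : Matrix (Fin N) (Fin N) ℂ) (t : ℂ) :
    (Matrix.scalar (Fin N) t - M).det =
      ∑ j ∈ Finset.range (N + 1), (-1) ^ j * secular j M * t ^ (N - j) := by
  rw [← Matrix.eval_charpoly, Polynomial.eval_eq_sum_range, Matrix.charpoly_natDegree_eq_dim,
    Fintype.card_fin, ← Finset.sum_range_reflect]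
  refine Finset.sum_congr rfl fun j hj => ?_
  have hj' : j ≤ N := Nat.lt_succ_iff.mp (Finset.mem_range.mp hj)
  have h1 : N + 1 - 1 - j = N - j := by omega
  rw [h1, secular, if_pos hj', ← mul_assoc, ← pow_add, Even.neg_one_pow ⟨j, rfl⟩, one_mul]

/-- `h_n(x) = N^(-n/2) H_n(√N x)`, the monic Hermite polynomials orthogonal for the weight
`exp (-N x² / 2)`; `H_n` is the probabilists' Hermite polynomial, orthogonal for
`exp (-x² / 2)`. -/
def scaledHermite (N n : ℕ) (x : ℂ) : ℂ :=
  (((√(N : ℝ) : ℝ) : ℂ) ^ n)⁻¹ *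
    Polynomial.aeval (((√(N : ℝ) : ℝ) : ℂ) * x) (Polynomial.hermite n)

end

/-!
Let `c_a` be the coefficient of `xᵃ` in `det (x - M)`. The generating functions
`F(x, y) = E[det (x - M) det (y - M)]` of the moments `E[c_a c_b]` and
`T(x, y) = N⁻¹ E[tr (adj (x - M) adj (y - M))]` satisfy two relations. Homogeneity of `c_a` and
`c_b`, Gaussian integration by parts and the unitarily invariant covariance of the entries give
`(2N - x∂ₓ - y∂ᵧ) F = 2T - N⁻¹ (∂ₓ² + ∂ᵧ²) F`; Jacobi's formula and the identity
`(x - y) adj (x - M) adj (y - M) = det (x - M) adj (y - M) - det (y - M) adj (x - M)` give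
`(x - y) T = N⁻¹ (∂ᵧ - ∂ₓ) F`. Together they express each coefficient of `F` by coefficients of
higher degree, so they have one solution with leading term `xᴺyᴺ`.

By the Christoffel–Darboux formula and its weighted version, `∑_{k ≤ N} (N! / k!) H_k(x) H_k(y)`
and `∑_{k ≤ N} (N - k) (N! / k!) H_k(x) H_k(y)` solve these equations with `N⁻¹` replaced by `1`;
rescaling the variables by `√N` identifies `F` with a rescaled Hermite kernel. The parity of `H_k`
and its explicit coefficients then yield the second moments, and `Sc_0 = 1` the first ones.
-/

section

open Polynomial

noncomputable section

section Jacobi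

variable {R A n : Type*} [CommRing R] [CommRing A] [Algebra R A] [Fintype n]
  (d : Derivation R A A)

theorem derivation_prod {ι : Type*} [DecidableEq ι] (s : Finset ι) (f : ι → A) :
    d (∏ i ∈ s, f i) = ∑ i ∈ s, (∏ j ∈ s.erase i, f j) * d (f i) := by
  induction s using Finset.induction_on with
  | empty => simp
  | insert a s ha ih =>
    rw [Finset.prod_insert ha, d.leibniz, ih, Finset.sum_insert ha, Finset.erase_insert ha,
      smul_eq_mul, smul_eq_mul, Finset.mul_sum, add_comm]
    congr 1
    refine Finset.sum_congr rfl fun i hi => ?_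
    have hia : a ≠ i := (ne_of_mem_of_not_mem hi ha).symm
    rw [Finset.erase_insert_of_ne hia, Finset.prod_insert (by simp [ha]), mul_assoc]

theorem map_derivation_mul (M M' : Matrix n n A) :
    (M * M').map d = M.map d * M' + M * M'.map d := by
  ext i j
  simp only [Matrix.mul_apply, map_sum, d.leibniz, smul_eq_mul, Matrix.add_apply,
    Matrix.map_apply, ← Finset.sum_add_distrib]
  exact Finset.sum_congr rfl fun k _ => by ring

theorem derivation_trace (M : Matrix n n A) : d M.trace = (M.map d).trace := by
  simp [Matrix.trace]

variable [DecidableEq n]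

omit [Fintype n] in
theorem map_derivation_smul_one (a : A) :
    (a • (1 : Matrix n n A)).map d = d a • (1 : Matrix n n A) := by
  ext i j
  by_cases hij : i = j <;> simp [hij]

theorem derivation_det (M : Matrix n n A) : d M.det = (M.adjugate * M.map d).trace := by
  have cramer : (M.adjugate * M.map d).trace = ∑ i, (M.updateCol i fun j => d (M j i)).det := by
    refine Finset.sum_congr rfl fun i _ => ?_
    rw [← Matrix.cramer_apply, Matrix.cramer_eq_adjugate_mulVec]
    rfl
  rw [cramer, Matrix.det_apply]
  simp only [Matrix.det_apply, map_sum]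
  rw [Finset.sum_comm]
  refine Finset.sum_congr rfl fun σ _ => ?_
  rw [Units.smul_def, map_zsmul, derivation_prod, Finset.smul_sum]
  refine Finset.sum_congr rfl fun i _ => ?_
  rw [Units.smul_def, ← Finset.mul_prod_erase _ _ (Finset.mem_univ i), mul_comm]
  congr 2
  · simp
  · refine Finset.prod_congr rfl fun j hj => ?_
    rw [Matrix.updateCol_ne (Finset.ne_of_mem_erase hj)]

theorem det_smul_map_derivation_adjugate (M : Matrix n n A) :
    M.det • M.adjugate.map d =
      d M.det • M.adjugate - M.adjugate * M.map d * M.adjugate := by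
  have leibniz : M.adjugate.map d * M = d M.det • (1 : Matrix n n A) - M.adjugate * M.map d := by
    rw [← map_derivation_smul_one, ← Matrix.adjugate_mul, map_derivation_mul, add_sub_cancel_right]
  calc M.det • M.adjugate.map d = M.adjugate.map d * M * M.adjugate := by
        rw [Matrix.mul_assoc, Matrix.mul_adjugate, Matrix.mul_smul, Matrix.mul_one]
    _ = _ := by rw [leibniz, Matrix.sub_mul, Matrix.smul_mul, Matrix.one_mul]

theorem det_mul_derivation_derivation_det (M : Matrix n n A) (hM : (M.map d).map d = 0) :
    M.det * d (d M.det) = (M.adjugate * M.map d).trace * (M.adjugate * M.map d).trace -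
      (M.adjugate * M.map d * (M.adjugate * M.map d)).trace := by
  calc M.det * d (d M.det) = (M.det • M.adjugate.map d * M.map d).trace := by
        conv_lhs => rw [derivation_det d M, derivation_trace, map_derivation_mul, hM]
        rw [Matrix.mul_zero, add_zero, Matrix.smul_mul, Matrix.trace_smul, smul_eq_mul]
    _ = _ := by
        rw [det_smul_map_derivation_adjugate, derivation_det, Matrix.sub_mul, Matrix.trace_sub,
          Matrix.smul_mul, Matrix.trace_smul, smul_eq_mul]
        simp only [Matrix.mul_assoc]

/-- The extension of a derivation of `A` to `A[X]` that acts on coefficients and kills `X`. -/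
def coeffwiseDerivation : Derivation R A[X] A[X] :=
  PolynomialModule.equivPolynomialSelf.toLinearMap.compDer d.mapCoeffs

theorem coeff_coeffwiseDerivation (p : A[X]) (a : ℕ) :
    (coeffwiseDerivation d p).coeff a = d (p.coeff a) := rfl

theorem coeffwiseDerivation_C (a : A) : coeffwiseDerivation d (C a) = C (d a) := by
  ext i
  rw [coeff_coeffwiseDerivation, coeff_C, coeff_C, apply_ite d, map_zero]

theorem coeffwiseDerivation_X : coeffwiseDerivation d (X : A[X]) = 0 := by
  ext i
  rw [coeff_coeffwiseDerivation, coeff_X, apply_ite d, map_zero, d.map_one_eq_zero, ite_self,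
    coeff_zero]

theorem map_coeffwiseDerivation_charmatrix (M : Matrix n n A) :
    M.charmatrix.map (coeffwiseDerivation d) = -(M.map d).map C := by
  ext1 i j
  simp only [Matrix.map_apply, Matrix.neg_apply, Matrix.charmatrix_apply, Matrix.diagonal_apply,
    map_sub, apply_ite (coeffwiseDerivation d), coeffwiseDerivation_C, coeffwiseDerivation_X,
    map_zero, ite_self, zero_sub]

end Jacobi

section AdjugateCoefficients

variable {A n : Type*} [CommRing A] [Fintype n] [DecidableEq n] (M : Matrix n n A)

theorem map_derivative_charmatrix : M.charmatrix.map (derivative' (R := A)) = 1 := by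
  ext1 i j
  rcases eq_or_ne i j with rfl | hij
  · simp [derivative']
  · simp [hij, derivative']

theorem derivative_charpoly : derivative M.charpoly = M.charmatrix.adjugate.trace := by
  have jacobi := derivation_det derivative' M.charmatrix
  rwa [map_derivative_charmatrix, Matrix.mul_one] at jacobi

theorem charpoly_mul_derivative_derivative_charpoly :
    M.charpoly * derivative (derivative M.charpoly) =
      M.charmatrix.adjugate.trace * M.charmatrix.adjugate.trace -
        (M.charmatrix.adjugate * M.charmatrix.adjugate).trace := by
  have second_derivative := det_mul_derivation_derivation_det derivative' M.charmatrix (by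
    ext1 i j
    by_cases hij : i = j <;> simp [map_derivative_charmatrix, hij])
  rwa [map_derivative_charmatrix, Matrix.mul_one] at second_derivative

/-- The matrix coefficient of `X ^ a` in the adjugate of `X - M`. -/
def adjugateCoeff (a : ℕ) : Matrix n n A := (matPolyEquiv M.charmatrix.adjugate).coeff a

theorem adjugateCoeff_apply (a : ℕ) (i j : n) :
    adjugateCoeff M a i j = (M.charmatrix.adjugate i j).coeff a :=
  matPolyEquiv_coeff_apply ..

theorem matPolyEquiv_smul_one_coeff (p : A[X]) (a : ℕ) :
    (matPolyEquiv (p • (1 : Matrix n n A[X]))).coeff a = p.coeff a • (1 : Matrix n n A) := by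
  ext i j
  rw [matPolyEquiv_coeff_apply, Matrix.smul_apply, Matrix.smul_apply]
  rcases eq_or_ne i j with rfl | hij
  · simp
  · simp [hij]

theorem adjugateCoeff_sub_mul (a : ℕ) :
    adjugateCoeff M a - adjugateCoeff M (a + 1) * M =
      M.charpoly.coeff (a + 1) • (1 : Matrix n n A) := by
  rw [← matPolyEquiv_smul_one_coeff, Matrix.charpoly, ← Matrix.adjugate_mul, map_mul,
    Matrix.matPolyEquiv_charmatrix, coeff_mul_X_sub_C, adjugateCoeff, adjugateCoeff]

theorem adjugateCoeff_sub_mul' (a : ℕ) :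
    adjugateCoeff M a - M * adjugateCoeff M (a + 1) =
      M.charpoly.coeff (a + 1) • (1 : Matrix n n A) := by
  rw [← matPolyEquiv_smul_one_coeff, Matrix.charpoly, ← Matrix.mul_adjugate, map_mul,
    Matrix.matPolyEquiv_charmatrix, coeff_X_sub_C_mul, adjugateCoeff, adjugateCoeff]

theorem adjugateCoeff_zero_mul :
    adjugateCoeff M 0 * M = -(M.charpoly.coeff 0 • (1 : Matrix n n A)) := by
  rw [← matPolyEquiv_smul_one_coeff, Matrix.charpoly, ← Matrix.adjugate_mul, map_mul,
    Matrix.matPolyEquiv_charmatrix, mul_coeff_zero, coeff_sub, coeff_X_zero, coeff_C_zero, zero_sub,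
    mul_neg, neg_neg, adjugateCoeff]

theorem trace_adjugateCoeff (a : ℕ) :
    (adjugateCoeff M a).trace = (a + 1) * M.charpoly.coeff (a + 1) := by
  rw [mul_comm, ← coeff_derivative, derivative_charpoly, Matrix.trace, Matrix.trace,
    finsetSum_coeff]
  simp only [Matrix.diag, adjugateCoeff_apply]

theorem trace_adjugateCoeff_mul (a : ℕ) :
    (adjugateCoeff M a * M).trace = (a - Fintype.card n) * M.charpoly.coeff a := by
  rcases a with _ | a
  · simp [adjugateCoeff_zero_mul, Matrix.trace_smul, mul_comm]
  · rw [← sub_sub_cancel (adjugateCoeff M a) (adjugateCoeff M (a + 1) * M), adjugateCoeff_sub_mul,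
      Matrix.trace_sub, trace_adjugateCoeff, Matrix.trace_smul, Matrix.trace_one, smul_eq_mul]
    push_cast
    ring

theorem trace_adjugateCoeff_mul_adjugateCoeff (a : ℕ) (B : Matrix n n A) :
    (adjugateCoeff M a * B).trace =
      (adjugateCoeff M (a + 1) * (B * M)).trace + M.charpoly.coeff (a + 1) * B.trace := by
  rw [sub_eq_iff_eq_add'.mp (adjugateCoeff_sub_mul' M a), Matrix.add_mul, Matrix.trace_add,
    Matrix.mul_assoc, Matrix.trace_mul_comm M, Matrix.mul_assoc, Matrix.smul_mul, Matrix.one_mul,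
    Matrix.trace_smul, smul_eq_mul]

theorem trace_adjugateCoeff_mul_zero (a : ℕ) :
    (adjugateCoeff M a * adjugateCoeff M 0).trace =
      M.charpoly.coeff (a + 1) * M.charpoly.coeff 1 -
        (a + 2) * (M.charpoly.coeff (a + 2) * M.charpoly.coeff 0) := by
  rw [trace_adjugateCoeff_mul_adjugateCoeff, adjugateCoeff_zero_mul, Matrix.mul_neg,
    Matrix.trace_neg, Matrix.mul_smul, Matrix.mul_one, Matrix.trace_smul, smul_eq_mul,
    trace_adjugateCoeff, trace_adjugateCoeff]
  push_cast
  ring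

theorem trace_adjugateCoeff_mul_succ (a b : ℕ) :
    (adjugateCoeff M a * adjugateCoeff M (b + 1)).trace =
      (adjugateCoeff M (a + 1) * adjugateCoeff M b).trace +
      ((b + 2) * (M.charpoly.coeff (a + 1) * M.charpoly.coeff (b + 2)) -
        (a + 2) * (M.charpoly.coeff (a + 2) * M.charpoly.coeff (b + 1))) := by
  rw [trace_adjugateCoeff_mul_adjugateCoeff, sub_eq_iff_eq_add'.mp (adjugateCoeff_sub_mul M b),
    Matrix.mul_add, Matrix.trace_add, Matrix.mul_smul, Matrix.mul_one, Matrix.trace_smul,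
    smul_eq_mul, trace_adjugateCoeff, trace_adjugateCoeff]
  push_cast
  ring

end AdjugateCoefficients

section UnitarilyInvariantCovariance

variable {n κ : Type*} [DecidableEq n] [Fintype κ]

/-- The family `E` has the covariance of a unitarily invariant ensemble of Hermitian matrices:
an entry is correlated, with covariance `τ`, only with the one across the diagonal. -/
def HasUnitaryCovariance {S : Type*} [CommRing S] (E : κ → Matrix n n S) (τ : S) : Prop :=
  ∀ i j l m, ∑ k, E k i j * E k l m = if i = m ∧ j = l then τ else 0

variable [Fintype n]

section Sums

variable {S : Type*} [CommRing S] {E : κ → Matrix n n S} {τ : S}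

theorem sum_trace_mul_smul (hE : HasUnitaryCovariance E τ) (B : Matrix n n S) :
    ∑ k, (B * E k).trace • E k = τ • B := by
  ext l m
  have entries : ∀ k, ((B * E k).trace • E k) l m = ∑ i, ∑ j, B i j * (E k j i * E k l m) := by
    intro k
    simp only [Matrix.smul_apply, smul_eq_mul, Matrix.trace, Matrix.diag, Matrix.mul_apply,
      Finset.sum_mul, mul_assoc]
  simp only [Matrix.sum_apply, entries, Matrix.smul_apply, smul_eq_mul]
  rw [Finset.sum_comm]
  simp only [Finset.sum_comm (s := (Finset.univ : Finset κ)), ← Finset.mul_sum, hE _ _ _ _]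
  simp [ite_and, mul_comm]

theorem sum_mul_mul (hE : HasUnitaryCovariance E τ) (B : Matrix n n S) :
    ∑ k, E k * B * E k = (τ * B.trace) • (1 : Matrix n n S) := by
  ext i m
  have entries : ∀ k, (E k * B * E k) i m = ∑ l, ∑ j, B j l * (E k i j * E k l m) := by
    intro k
    simp only [Matrix.mul_apply, Finset.sum_mul]
    exact Finset.sum_congr rfl fun l _ => Finset.sum_congr rfl fun j _ => by ring
  simp only [Matrix.sum_apply, entries]
  rw [Finset.sum_comm]
  simp only [Finset.sum_comm (s := (Finset.univ : Finset κ)), ← Finset.mul_sum, hE _ _ _ _]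
  simp [ite_and, Matrix.one_apply, Matrix.trace, Finset.mul_sum, mul_comm]

theorem sum_trace_mul_mul_trace_mul
    (hE : HasUnitaryCovariance E τ) (B B' : Matrix n n S) :
    ∑ k, (B * E k).trace * (B' * E k).trace = τ * (B * B').trace := by
  calc ∑ k, (B * E k).trace * (B' * E k).trace
      = (B' * ∑ k, (B * E k).trace • E k).trace := by
        simp only [Matrix.mul_sum, Matrix.trace_sum, Matrix.mul_smul, Matrix.trace_smul,
          smul_eq_mul]
    _ = τ * (B * B').trace := by
        rw [sum_trace_mul_smul hE, Matrix.mul_smul, Matrix.trace_smul, Matrix.trace_mul_comm,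
          smul_eq_mul]

theorem sum_trace_mul_mul_mul
    (hE : HasUnitaryCovariance E τ) (B B' : Matrix n n S) :
    ∑ k, (B * E k * (B' * E k)).trace = τ * (B.trace * B'.trace) := by
  calc ∑ k, (B * E k * (B' * E k)).trace = (B * ∑ k, E k * B' * E k).trace := by
        simp only [Matrix.mul_sum, Matrix.trace_sum, Matrix.mul_assoc]
    _ = τ * (B.trace * B'.trace) := by
        rw [sum_mul_mul hE, Matrix.mul_smul, Matrix.mul_one, Matrix.trace_smul, smul_eq_mul]
        ring

end Sums

variable {R A : Type*} [CommRing R] [CommRing A] [Algebra R A] (M : Matrix n n A)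

omit [Fintype κ] in
theorem derivation_charpoly_coeff (d : Derivation R A A) (a : ℕ) :
    d (M.charpoly.coeff a) = -(adjugateCoeff M a * M.map d).trace := by
  rw [← coeff_coeffwiseDerivation, Matrix.charpoly, derivation_det,
    map_coeffwiseDerivation_charmatrix, Matrix.mul_neg, Matrix.trace_neg, coeff_neg]
  simp only [Matrix.trace, Matrix.diag, Matrix.mul_apply, finsetSum_coeff, Matrix.map_apply,
    coeff_mul_C, adjugateCoeff_apply]

variable {d : κ → Derivation R A A} {τ : A}

theorem sum_derivation_charpoly_coeff_mul
    (hM : HasUnitaryCovariance (fun k => M.map (d k)) τ) (a b : ℕ) :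
    ∑ k, d k (M.charpoly.coeff a) * d k (M.charpoly.coeff b) =
      τ * (adjugateCoeff M a * adjugateCoeff M b).trace := by
  simp only [derivation_charpoly_coeff, neg_mul_neg]
  exact sum_trace_mul_mul_trace_mul hM _ _

theorem sum_coeffwiseDerivation_charpoly
    (hM : HasUnitaryCovariance (fun k => M.map (d k)) τ)
    (hM' : ∀ k i j, d k (d k (M i j)) = 0) :
    ∑ k, coeffwiseDerivation (d k) (coeffwiseDerivation (d k) M.charpoly) =
      -(C τ * derivative (derivative M.charpoly)) := by
  have covariance :
      HasUnitaryCovariance (fun k => M.charmatrix.map (coeffwiseDerivation (d k))) (C τ) := by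
    intro i j l m
    have covariance_apply := hM i j l m
    simp only [map_coeffwiseDerivation_charmatrix]
    simp only [Matrix.neg_apply, Matrix.map_apply, neg_mul_neg, ← C_mul, ← map_sum]
      at covariance_apply ⊢
    rw [covariance_apply, apply_ite C, map_zero]
  have second_derivative (k : κ) :
      M.charpoly * coeffwiseDerivation (d k) (coeffwiseDerivation (d k) M.charpoly) = _ :=
    det_mul_derivation_derivation_det (coeffwiseDerivation (d k)) M.charmatrix (by
      ext1 i j
      simp [map_coeffwiseDerivation_charmatrix, coeffwiseDerivation_C, hM'])
  refine M.charpoly_monic.isRegular.left ?_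
  change M.charpoly * _ = M.charpoly * _
  rw [Finset.mul_sum, Finset.sum_congr rfl fun k _ => second_derivative k, Finset.sum_sub_distrib,
    sum_trace_mul_mul_trace_mul covariance, sum_trace_mul_mul_mul covariance]
  linear_combination C τ * charpoly_mul_derivative_derivative_charpoly M

theorem sum_derivation_derivation_charpoly_coeff
    (hM : HasUnitaryCovariance (fun k => M.map (d k)) τ)
    (hM' : ∀ k i j, d k (d k (M i j)) = 0) (a : ℕ) :
    ∑ k, d k (d k (M.charpoly.coeff a)) =
      -(τ * ((a + 2) * (a + 1) * M.charpoly.coeff (a + 2))) := by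
  have coefficients := congrArg (coeff · a) (sum_coeffwiseDerivation_charpoly M hM hM')
  simp only [finsetSum_coeff, coeff_coeffwiseDerivation, coeff_neg, coeff_C_mul,
    coeff_derivative] at coefficients
  rw [coefficients]
  push_cast
  ring

theorem sum_mul_derivation_charpoly_coeff {x : κ → A}
    (hx : ∀ i j, ∑ k, x k * d k (M i j) = M i j) (a : ℕ) :
    ∑ k, x k * d k (M.charpoly.coeff a) = (Fintype.card n - a) * M.charpoly.coeff a := by
  have euler : ∑ k, x k • M.map (d k) = M := by
    ext i j
    simp only [Matrix.sum_apply, Matrix.smul_apply, Matrix.map_apply, smul_eq_mul, hx]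
  calc ∑ k, x k * d k (M.charpoly.coeff a)
      = -(adjugateCoeff M a * ∑ k, x k • M.map (d k)).trace := by
        simp only [derivation_charpoly_coeff, Matrix.mul_sum, Matrix.trace_sum, Matrix.mul_smul,
          Matrix.trace_smul, smul_eq_mul, mul_neg, Finset.sum_neg_distrib]
    _ = (Fintype.card n - a) * M.charpoly.coeff a := by
        rw [euler, trace_adjugateCoeff_mul]
        ring

end UnitarilyInvariantCovariance

section MomentEquations

/-- The coefficient form, with `F = ∑ F a b xᵃyᵇ` and `T = ∑ T a b xᵃyᵇ`, of the equations
`(2N - x∂ₓ - y∂ᵧ) F = 2T - τ (∂ₓ² + ∂ᵧ²) F` and `(x - y) T = τ (∂ᵧ - ∂ₓ) F` for a polynomial `F` of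
degree `N` in each variable with leading term `xᴺyᴺ`. -/
structure MomentEquations {R : Type*} [CommRing R] (N : ℕ) (τ : R) (F T : ℕ → ℕ → R) : Prop where
  of_lt : ∀ {a b}, N < a ∨ N < b → F a b = 0
  top : F N N = 1
  euler : ∀ a b, (2 * N - a - b) * F a b =
    2 * T a b - τ * ((a + 2) * (a + 1) * F (a + 2) b) - τ * ((b + 2) * (b + 1) * F a (b + 2))
  zero : ∀ a, T a 0 = τ * (F (a + 1) 1 - (a + 2) * F (a + 2) 0)
  succ : ∀ a b, T a (b + 1) =
    T (a + 1) b + τ * ((b + 2) * F (a + 1) (b + 2) - (a + 2) * F (a + 2) (b + 1))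

namespace MomentEquations

variable {N : ℕ}

theorem unique {R : Type*} [CommRing R] [NoZeroDivisors R] [CharZero R] {τ : R}
    {F T F' T' : ℕ → ℕ → R} (h : MomentEquations N τ F T) (h' : MomentEquations N τ F' T') :
    F = F' := by
  have top_degree : ∀ a b, 2 * N ≤ a + b → F a b = F' a b := by
    intro a b hab
    by_cases hlt : N < a ∨ N < b
    · rw [h.of_lt hlt, h'.of_lt hlt]
    · obtain rfl : a = N := by omega
      obtain rfl : b = a := by omega
      rw [h.top, h'.top]
  have descent : ∀ n a b, 2 * N ≤ a + b + n → F a b = F' a b := by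
    intro n
    induction n with
    | zero => exact top_degree
    | succ n ih =>
      have eq_T : ∀ b a, 2 * N ≤ a + b + (n + 2) → T a b = T' a b := by
        intro b
        induction b with
        | zero =>
          intro a hab
          rw [h.zero, h'.zero, ih _ _ (by omega), ih _ _ (by omega)]
        | succ b ihb =>
          intro a hab
          rw [h.succ, h'.succ, ihb _ (by omega), ih _ _ (by omega), ih _ _ (by omega)]
      intro a b hab
      by_cases hdeg : 2 * N ≤ a + b
      · exact top_degree a b hdeg
      · have hne : (2 * N - a - b : R) ≠ 0 := by
          rw [sub_sub, sub_ne_zero]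
          exact_mod_cast (not_le.mp hdeg).ne'
        refine mul_left_cancel₀ hne ?_
        rw [h.euler, h'.euler, eq_T b a (by omega), ih (a + 2) b (by omega),
          ih a (b + 2) (by omega)]
  ext a b
  exact descent (2 * N) a b (by omega)

theorem rescale {K : Type*} [Field K] {F T : ℕ → ℕ → K} (h : MomentEquations N 1 F T) {s : K}
    (hs : s ≠ 0) :
    MomentEquations N (s ^ 2)⁻¹ (fun a b => s ^ (a + b) / s ^ (2 * N) * F a b)
      (fun a b => s ^ (a + b) / s ^ (2 * N) * T a b) where
  of_lt hlt := by rw [h.of_lt hlt, mul_zero]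
  top := by rw [h.top, mul_one, ← two_mul, div_self (pow_ne_zero _ hs)]
  euler a b := by
    have euler := h.euler a b
    field_simp
    linear_combination s ^ 2 * s ^ (a + b) * euler
  zero a := by
    rw [h.zero]
    field_simp
    ring
  succ a b := by
    rw [h.succ]
    field_simp
    ring

end MomentEquations

end MomentEquations

section HermiteKernel

theorem derivative_hermite_succ (n : ℕ) :
    derivative (hermite (n + 1)) = ((n : ℤ[X]) + 1) * hermite n := by
  induction n with
  | zero => simp
  | succ n ih =>
    conv_lhs => rw [hermite_succ, derivative_sub, derivative_mul, derivative_X, ih]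
    rw [hermite_succ n]
    simp only [derivative_mul, derivative_add, derivative_natCast, derivative_one]
    push_cast
    ring

variable {K : Type*} [Field K]

variable (K) in
/-- The coefficient of `X ^ a` in the Hermite polynomial `H_k`, as an element of `K`. -/
def hermiteCoeff (k a : ℕ) : K := ((hermite k).coeff a : ℤ)

variable (K) in
/-- The coefficient of `X ^ a` in `X * H_k`, as an element of `K`. -/
def hermiteXCoeff (k a : ℕ) : K := ((X * hermite k).coeff a : ℤ)

theorem hermiteXCoeff_zero (k : ℕ) : hermiteXCoeff K k 0 = 0 := by simp [hermiteXCoeff]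

theorem hermiteXCoeff_succ (k a : ℕ) : hermiteXCoeff K k (a + 1) = hermiteCoeff K k a := by
  simp [hermiteXCoeff, hermiteCoeff, coeff_X_mul]

theorem hermiteCoeff_self (k : ℕ) : hermiteCoeff K k k = 1 := by
  rw [hermiteCoeff, coeff_hermite_self, Int.cast_one]

theorem hermiteCoeff_of_lt {k a : ℕ} (h : k < a) : hermiteCoeff K k a = 0 := by
  rw [hermiteCoeff, coeff_hermite_of_lt h, Int.cast_zero]

theorem hermiteCoeff_of_odd {k a : ℕ} (h : Odd (k + a)) : hermiteCoeff K k a = 0 := by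
  rw [hermiteCoeff, coeff_hermite_of_odd_add h, Int.cast_zero]

theorem succ_mul_hermiteCoeff_succ (k a : ℕ) :
    (a + 1) * hermiteCoeff K k (a + 1) = k * hermiteCoeff K (k - 1) a := by
  rcases k with _ | k
  · simp [hermiteCoeff, coeff_one]
  · have coefficients := congrArg (fun p => ((p.coeff a : ℤ) : K)) (derivative_hermite_succ k)
    have natCast_add_one : (k : ℤ[X]) + 1 = C ((k : ℤ) + 1) := by simp
    simp only [natCast_add_one, coeff_derivative, coeff_C_mul] at coefficients
    push_cast at coefficients
    rw [hermiteCoeff, hermiteCoeff, mul_comm, coefficients, Nat.cast_add_one, Nat.add_sub_cancel]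

theorem hermiteCoeff_succ (k a : ℕ) :
    hermiteCoeff K (k + 1) a = hermiteXCoeff K k a - (a + 1) * hermiteCoeff K k (a + 1) := by
  rw [hermiteCoeff, hermite_succ, coeff_sub, coeff_derivative, hermiteXCoeff, hermiteCoeff]
  push_cast
  ring

theorem hermiteXCoeff_eq_add (k a : ℕ) :
    hermiteXCoeff K k a = hermiteCoeff K (k + 1) a + k * hermiteCoeff K (k - 1) a := by
  rw [hermiteCoeff_succ, succ_mul_hermiteCoeff_succ]
  ring

/-- The Hermite differential equation `x H_k' = k H_k + H_k''`, on coefficients. -/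
theorem mul_hermiteCoeff (k a : ℕ) :
    a * hermiteCoeff K k a =
      k * hermiteCoeff K k a + (a + 2) * (a + 1) * hermiteCoeff K k (a + 2) := by
  have lowering : a * hermiteCoeff K k a = k * hermiteXCoeff K (k - 1) a := by
    rcases a with _ | a
    · simp [hermiteXCoeff_zero]
    · rw [hermiteXCoeff_succ, ← succ_mul_hermiteCoeff_succ, Nat.cast_add_one]
  have lowering_succ : (a + 2) * hermiteCoeff K k (a + 2) = k * hermiteCoeff K (k - 1) (a + 1) := by
    rw [← succ_mul_hermiteCoeff_succ]
    push_cast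
    ring
  have raising : k * hermiteCoeff K k a =
      k * (hermiteXCoeff K (k - 1) a - (a + 1) * hermiteCoeff K (k - 1) (a + 1)) := by
    rcases k with _ | k
    · simp
    · rw [hermiteCoeff_succ, Nat.add_sub_cancel]
  linear_combination lowering - raising - (a + 1) * lowering_succ

section ChristoffelDarboux

variable [CharZero K] {p q xp xq : ℕ → K}

theorem sum_christoffelDarboux (hp : ∀ k, xp k = p (k + 1) + k * p (k - 1))
    (hq : ∀ k, xq k = q (k + 1) + k * q (k - 1)) (N : ℕ) :
    ∑ k ∈ Finset.range (N + 1), (p k * xq k - xp k * q k) / k.factorial =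
      (p N * q (N + 1) - p (N + 1) * q N) / N.factorial := by
  induction N with
  | zero => simp [hp, hq]
  | succ N ih =>
    rw [Finset.sum_range_succ, ih, hp, hq, Nat.factorial_succ, Nat.add_sub_cancel]
    have := Nat.cast_ne_zero (R := K).mpr N.factorial_ne_zero
    have := Nat.cast_add_one_ne_zero (R := K) N
    push_cast
    field_simp
    ring

theorem sum_weighted_christoffelDarboux (hp : ∀ k, xp k = p (k + 1) + k * p (k - 1))
    (hq : ∀ k, xq k = q (k + 1) + k * q (k - 1)) (N : ℕ) :
    ∑ k ∈ Finset.range (N + 1), ((N : K) - k) * ((p k * xq k - xp k * q k) / k.factorial) =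
      ∑ k ∈ Finset.range (N + 1), k * (p (k - 1) * q k - p k * q (k - 1)) / k.factorial := by
  induction N with
  | zero => simp
  | succ N ih =>
    have weight_succ : ∀ k : ℕ, ((N + 1 : ℕ) : K) - k = (N - k) + 1 := fun k => by
      push_cast
      ring
    have := Nat.cast_add_one_ne_zero (R := K) N
    have := Nat.cast_ne_zero (R := K).mpr N.factorial_ne_zero
    rw [Finset.sum_range_succ, Finset.sum_range_succ _ (N + 1), ← ih, sub_self, zero_mul, add_zero]
    simp only [weight_succ, add_mul, one_mul, Finset.sum_add_distrib]
    rw [sum_christoffelDarboux hp hq, Nat.factorial_succ, Nat.add_sub_cancel]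
    push_cast
    field_simp

end ChristoffelDarboux

variable (K) in
/-- The coefficient of `xᵃyᵇ` in `∑_{k ≤ N} (N! / k!) H_k(x) H_k(y)`. -/
def hermiteKernel (N a b : ℕ) : K :=
  ∑ k ∈ Finset.range (N + 1),
    (N.factorial / k.factorial : K) * (hermiteCoeff K k a * hermiteCoeff K k b)

variable (K) in
/-- The coefficient of `xᵃyᵇ` in `∑_{k ≤ N} (N - k) (N! / k!) H_k(x) H_k(y)`. -/
def hermiteWeightedKernel (N a b : ℕ) : K :=
  ∑ k ∈ Finset.range (N + 1),
    (N - k : K) * ((N.factorial / k.factorial : K) * (hermiteCoeff K k a * hermiteCoeff K k b))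

theorem hermiteKernel_euler (N a b : ℕ) :
    (2 * N - a - b) * hermiteKernel K N a b =
      2 * hermiteWeightedKernel K N a b - (a + 2) * (a + 1) * hermiteKernel K N (a + 2) b -
        (b + 2) * (b + 1) * hermiteKernel K N a (b + 2) := by
  simp only [hermiteKernel, hermiteWeightedKernel, Finset.mul_sum, ← Finset.sum_sub_distrib]
  refine Finset.sum_congr rfl fun k _ => ?_
  linear_combination
    -(N.factorial / k.factorial * hermiteCoeff K k b : K) * mul_hermiteCoeff (K := K) k a
      - (N.factorial / k.factorial * hermiteCoeff K k a : K) * mul_hermiteCoeff (K := K) k b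

theorem sum_weighted_hermiteCoeff_sub [CharZero K] (N a b : ℕ) :
    ∑ k ∈ Finset.range (N + 1), (N - k : K) * ((N.factorial / k.factorial : K) *
        (hermiteCoeff K k a * hermiteXCoeff K k b - hermiteXCoeff K k a * hermiteCoeff K k b)) =
      (a + 1) * hermiteKernel K N (a + 1) b - (b + 1) * hermiteKernel K N a (b + 1) := by
  have christoffel_darboux := congrArg ((N.factorial : K) * ·) (sum_weighted_christoffelDarboux
    (p := (hermiteCoeff K · a)) (q := (hermiteCoeff K · b))
    (hermiteXCoeff_eq_add · a) (hermiteXCoeff_eq_add · b) N)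
  simp only [Finset.mul_sum, hermiteKernel, ← Finset.sum_sub_distrib] at christoffel_darboux ⊢
  refine (Finset.sum_congr rfl fun k _ => ?_).trans
    (christoffel_darboux.trans (Finset.sum_congr rfl fun k _ => ?_))
  · ring
  · linear_combination
      -(N.factorial / k.factorial * hermiteCoeff K k b : K) *
          succ_mul_hermiteCoeff_succ (K := K) k a
        + (N.factorial / k.factorial * hermiteCoeff K k a : K) *
          succ_mul_hermiteCoeff_succ (K := K) k b

theorem hermiteWeightedKernel_zero [CharZero K] (N a : ℕ) :
    hermiteWeightedKernel K N a 0 =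
      hermiteKernel K N (a + 1) 1 - (a + 2) * hermiteKernel K N (a + 2) 0 := by
  have christoffel_darboux := sum_weighted_hermiteCoeff_sub (K := K) N (a + 1) 0
  simp only [hermiteXCoeff_succ, hermiteXCoeff_zero, mul_zero, zero_sub, mul_neg,
    Finset.sum_neg_distrib] at christoffel_darboux
  rw [hermiteWeightedKernel]
  push_cast at christoffel_darboux
  linear_combination -christoffel_darboux

theorem hermiteWeightedKernel_succ [CharZero K] (N a b : ℕ) :
    hermiteWeightedKernel K N a (b + 1) = hermiteWeightedKernel K N (a + 1) b +
      ((b + 2) * hermiteKernel K N (a + 1) (b + 2) -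
        (a + 2) * hermiteKernel K N (a + 2) (b + 1)) := by
  have christoffel_darboux := sum_weighted_hermiteCoeff_sub (K := K) N (a + 1) (b + 1)
  simp only [hermiteXCoeff_succ, mul_sub, Finset.sum_sub_distrib] at christoffel_darboux
  rw [hermiteWeightedKernel, hermiteWeightedKernel]
  push_cast at christoffel_darboux
  linear_combination -christoffel_darboux

theorem hermiteKernel_of_lt {N a b : ℕ} (h : N < a ∨ N < b) : hermiteKernel K N a b = 0 := by
  refine Finset.sum_eq_zero fun k hk => ?_
  have hkN := Finset.mem_range_succ_iff.mp hk
  rcases h with h | h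
  · rw [hermiteCoeff_of_lt (hkN.trans_lt h), zero_mul, mul_zero]
  · rw [hermiteCoeff_of_lt (hkN.trans_lt h), mul_zero, mul_zero]

theorem hermiteKernel_self_right [CharZero K] (N a : ℕ) :
    hermiteKernel K N a N = hermiteCoeff K N a := by
  rw [hermiteKernel, Finset.sum_range_succ, Finset.sum_eq_zero, hermiteCoeff_self, zero_add,
    mul_one, div_self (Nat.cast_ne_zero.mpr N.factorial_ne_zero), one_mul]
  intro k hk
  rw [hermiteCoeff_of_lt (Finset.mem_range.mp hk), mul_zero, mul_zero]

theorem hermiteKernel_of_odd {N a b : ℕ} (h : Odd (a + b)) : hermiteKernel K N a b = 0 := by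
  refine Finset.sum_eq_zero fun k _ => ?_
  rcases Nat.even_or_odd (k + a) with hka | hka
  · rw [hermiteCoeff_of_odd (by grind : Odd (k + b)), mul_zero, mul_zero]
  · rw [hermiteCoeff_of_odd hka, zero_mul, mul_zero]

theorem momentEquations_hermiteKernel [CharZero K] (N : ℕ) :
    MomentEquations N (1 : K) (hermiteKernel K N) (hermiteWeightedKernel K N) where
  of_lt := hermiteKernel_of_lt
  top := by rw [hermiteKernel_self_right, hermiteCoeff_self]
  euler a b := by rw [hermiteKernel_euler, one_mul, one_mul]
  zero a := by rw [hermiteWeightedKernel_zero, one_mul]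
  succ a b := by rw [hermiteWeightedKernel_succ, one_mul]

theorem hermiteKernel_succ [CharZero K] (N a b : ℕ) :
    hermiteKernel K (N + 1) a b =
      (N + 1) * hermiteKernel K N a b + hermiteCoeff K (N + 1) a * hermiteCoeff K (N + 1) b := by
  rw [hermiteKernel, Finset.sum_range_succ,
    div_self (Nat.cast_ne_zero.mpr (N + 1).factorial_ne_zero), one_mul, hermiteKernel,
    Finset.mul_sum, Nat.factorial_succ]
  congr 1
  refine Finset.sum_congr rfl fun k _ => ?_
  push_cast
  ring

end HermiteKernel

section HermiteKernelExplicit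

theorem sum_range_succ_eq_sum_range_half {M : Type*} [AddCommMonoid M] {f : ℕ → M}
    {n : ℕ} (hf : ∀ j ≤ n, Odd j → f j = 0) :
    ∑ j ∈ Finset.range (n + 1), f j = ∑ j ∈ Finset.range (n / 2 + 1), f (2 * j) := by
  refine (Finset.sum_of_injOn (2 * ·) (mul_right_injective₀ two_ne_zero).injOn ?_ ?_
    fun _ _ => rfl).symm
  · intro j hj
    simp only [Finset.coe_range, Set.mem_Iio] at hj ⊢
    omega
  · intro k hk hk_image
    have hkn := Finset.mem_range.mp hk
    refine hf k (by omega) (Nat.not_even_iff_odd.mp fun hk_even => hk_image ?_)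
    simp only [Finset.coe_range, Set.mem_image, Set.mem_Iio]
    exact ⟨k / 2, by omega, Nat.two_mul_div_two_of_even hk_even⟩

variable {K : Type*} [Field K]

theorem hermiteKernel_sub_sub_eq_sum {N r s : ℕ} (hr : 2 * r ≤ N) (hs : 2 * s ≤ N) :
    hermiteKernel K N (N - 2 * r) (N - 2 * s) = ∑ j ∈ Finset.range (min r s + 1),
      (N.factorial / (N - 2 * j).factorial : K) *
        (hermiteCoeff K (N - 2 * j) (N - 2 * r) * hermiteCoeff K (N - 2 * j) (N - 2 * s)) := by
  rw [hermiteKernel, ← Finset.sum_range_reflect]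
  simp only [Nat.add_sub_cancel]
  rw [sum_range_succ_eq_sum_range_half fun j hjN hj => by
    rw [hermiteCoeff_of_odd (by grind : Odd (N - j + (N - 2 * r))), zero_mul, mul_zero]]
  symm
  refine Finset.sum_subset (Finset.range_subset_range.mpr (by omega)) fun j hj hj_notMem => ?_
  rw [Finset.mem_range, not_lt, Nat.succ_le_iff, min_lt_iff] at hj_notMem
  rcases hj_notMem with hrj | hsj
  · rw [hermiteCoeff_of_lt (by grind : N - 2 * j < N - 2 * r), zero_mul, mul_zero]
  · rw [hermiteCoeff_of_lt (by grind : N - 2 * j < N - 2 * s), mul_zero, mul_zero]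

variable [CharZero K]

theorem hermiteCoeff_two_mul_add (m a : ℕ) :
    hermiteCoeff K (2 * m + a) a =
      (-(1 / 2)) ^ m * ((2 * m + a).factorial / (m.factorial * a.factorial)) := by
  have factorial_two_mul :
      (2 * m - 1).doubleFactorial * (2 ^ m * m.factorial) = (2 * m).factorial := by
    rcases m with _ | m
    · simp
    · rw [← Nat.doubleFactorial_two_mul, show 2 * (m + 1) = 2 * m + 1 + 1 by ring,
        Nat.factorial_eq_mul_doubleFactorial, mul_comm, Nat.add_sub_cancel]
  have choose_mul_factorial :
      (2 * m + a).choose a * (2 * m).factorial * a.factorial = (2 * m + a).factorial :=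
    Nat.add_choose_mul_factorial_mul_factorial _ _
  have := Nat.cast_ne_zero (R := K).mpr m.factorial_ne_zero
  have := Nat.cast_ne_zero (R := K).mpr a.factorial_ne_zero
  rw [hermiteCoeff, coeff_hermite_explicit, ← choose_mul_factorial, ← factorial_two_mul,
    neg_pow (1 / 2 : K)]
  push_cast
  rw [div_pow, one_pow]
  field_simp

theorem hermiteKernel_sub_sub {N r s : ℕ} (hr : 2 * r ≤ N) (hs : 2 * s ≤ N) :
    hermiteKernel K N (N - 2 * r) (N - 2 * s) =
      (-(1 / 2)) ^ (r + s) * ∑ j ∈ Finset.range (min r s + 1),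
        2 ^ (2 * j) / (((r - j).factorial : K) * (s - j).factorial) *
          (((N.factorial : K) * (N - 2 * j).factorial) /
            (((N - 2 * r).factorial : K) * (N - 2 * s).factorial)) := by
  rw [hermiteKernel_sub_sub_eq_sum hr hs, Finset.mul_sum]
  refine Finset.sum_congr rfl fun j hj => ?_
  have hj' := Finset.mem_range.mp hj
  obtain ⟨m, rfl⟩ : ∃ m, r = m + j := ⟨r - j, by omega⟩
  obtain ⟨l, rfl⟩ : ∃ l, s = l + j := ⟨s - j, by omega⟩
  have degree_left : N - 2 * j = 2 * m + (N - 2 * (m + j)) := by omega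
  have degree_right : N - 2 * j = 2 * l + (N - 2 * (l + j)) := by omega
  have coeff_left := hermiteCoeff_two_mul_add (K := K) m (N - 2 * (m + j))
  have coeff_right := hermiteCoeff_two_mul_add (K := K) l (N - 2 * (l + j))
  rw [← degree_left] at coeff_left
  rw [← degree_right] at coeff_right
  have half_pow : (-(1 / 2) : K) ^ (2 * j) * 2 ^ (2 * j) = 1 := by
    rw [← mul_pow, pow_mul]
    norm_num
  have := Nat.cast_ne_zero (R := K).mpr (N - 2 * j).factorial_ne_zero
  calc (N.factorial / (N - 2 * j).factorial : K) * (hermiteCoeff K (N - 2 * j) (N - 2 * (m + j)) *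
        hermiteCoeff K (N - 2 * j) (N - 2 * (l + j)))
      = (-(1 / 2)) ^ (m + l) * (N.factorial * (N - 2 * j).factorial /
          (m.factorial * l.factorial *
            ((N - 2 * (m + j)).factorial * (N - 2 * (l + j)).factorial))) := by
        rw [coeff_left, coeff_right, pow_add]
        field_simp
    _ = (-(1 / 2)) ^ (m + l) * ((-(1 / 2)) ^ (2 * j) * 2 ^ (2 * j)) *
          (N.factorial * (N - 2 * j).factorial / (m.factorial * l.factorial *
            ((N - 2 * (m + j)).factorial * (N - 2 * (l + j)).factorial))) := by
        rw [half_pow, mul_one]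
    _ = _ := by
        rw [Nat.add_sub_cancel, Nat.add_sub_cancel]
        ring

theorem hermiteKernel_succ_sub_sub {N r s : ℕ} (hr : 2 * r ≤ N) :
    hermiteKernel K (N + 1) (N - 2 * r) (N - 2 * s) =
      (N + 1) * hermiteKernel K N (N - 2 * r) (N - 2 * s) := by
  rw [hermiteKernel_succ, hermiteCoeff_of_odd (by grind : Odd (N + 1 + (N - 2 * r))), zero_mul,
    add_zero]

end HermiteKernelExplicit

section GaussianFunctional

section CharpolyTop

variable {n A : Type*} [Fintype n] [DecidableEq n] [CommRing A] (M : Matrix n n A)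

theorem charpoly_coeff_card : M.charpoly.coeff (Fintype.card n) = 1 := by
  nontriviality A
  rw [← M.charpoly_natDegree_eq_dim, M.charpoly_monic.coeff_natDegree]

theorem charpoly_coeff_of_card_lt {a : ℕ} (h : Fintype.card n < a) : M.charpoly.coeff a = 0 := by
  nontriviality A
  exact coeff_eq_zero_of_natDegree_lt (by rwa [M.charpoly_natDegree_eq_dim])

end CharpolyTop

variable {κ R A : Type*} [Fintype κ] [CommRing R] [CommRing A] [Algebra R A]
  (d : κ → Derivation R A A)

theorem sum_mul_derivation_mul (x : κ → A) (p q : A) :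
    ∑ k, x k * d k (p * q) = p * ∑ k, x k * d k q + q * ∑ k, x k * d k p := by
  simp only [Finset.mul_sum, ← Finset.sum_add_distrib, Derivation.leibniz, smul_eq_mul]
  exact Finset.sum_congr rfl fun k _ => by ring

theorem sum_derivation_derivation_mul (p q : A) :
    ∑ k, d k (d k (p * q)) =
      p * ∑ k, d k (d k q) + q * ∑ k, d k (d k p) + 2 * ∑ k, d k p * d k q := by
  simp only [Finset.mul_sum, ← Finset.sum_add_distrib, Derivation.leibniz, smul_eq_mul, map_add]
  exact Finset.sum_congr rfl fun k _ => by ring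

variable {d} {n : Type*} [Fintype n] [DecidableEq n] {M : Matrix n n A} {x : κ → A} {τ : R}

theorem sum_mul_derivation_charpoly_coeff_mul
    (hx : ∀ i j, ∑ k, x k * d k (M i j) = M i j) (a b : ℕ) :
    ∑ k, x k * d k (M.charpoly.coeff a * M.charpoly.coeff b) =
      (2 * Fintype.card n - a - b : R) • (M.charpoly.coeff a * M.charpoly.coeff b) := by
  rw [sum_mul_derivation_mul, sum_mul_derivation_charpoly_coeff M hx,
    sum_mul_derivation_charpoly_coeff M hx, Algebra.smul_def]
  simp only [map_sub, map_mul, map_natCast, map_ofNat]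
  ring

theorem sum_derivation_derivation_charpoly_coeff_mul
    (hM : HasUnitaryCovariance (fun k => M.map (d k)) (algebraMap R A τ))
    (hM' : ∀ k i j, d k (d k (M i j)) = 0) (a b : ℕ) :
    ∑ k, d k (d k (M.charpoly.coeff a * M.charpoly.coeff b)) =
      (2 * τ) • (adjugateCoeff M a * adjugateCoeff M b).trace -
        (τ * ((a + 2) * (a + 1))) • (M.charpoly.coeff (a + 2) * M.charpoly.coeff b) -
        (τ * ((b + 2) * (b + 1))) • (M.charpoly.coeff a * M.charpoly.coeff (b + 2)) := by
  rw [sum_derivation_derivation_mul, sum_derivation_derivation_charpoly_coeff M hM hM',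
    sum_derivation_derivation_charpoly_coeff M hM hM', sum_derivation_charpoly_coeff_mul M hM]
  simp only [Algebra.smul_def, map_mul, map_add, map_natCast, map_ofNat, map_one]
  ring

theorem momentEquations_charpoly_coeff {E : A →ₗ[R] R} (hE_one : E 1 = 1)
    (hE : ∀ k p, E (x k * p) = E (d k p)) (hx : ∀ i j, ∑ k, x k * d k (M i j) = M i j)
    (hM : HasUnitaryCovariance (fun k => M.map (d k)) (algebraMap R A τ))
    (hM' : ∀ k i j, d k (d k (M i j)) = 0) :
    MomentEquations (Fintype.card n) τ (fun a b => E (M.charpoly.coeff a * M.charpoly.coeff b))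
      (fun a b => τ * E (adjugateCoeff M a * adjugateCoeff M b).trace) := by
  have map_add_two_mul (m : ℕ) (p : A) : E ((m + 2) * p) = (m + 2) * E p := by
    simpa only [map_add, map_natCast, map_ofNat] using E.map_algebraMap_mul p (m + 2)
  refine ⟨?of_lt, ?top, fun a b => ?euler, fun a => ?zero, fun a b => ?succ⟩
  case of_lt =>
    rintro a b (h | h)
    · rw [charpoly_coeff_of_card_lt M h, zero_mul, map_zero]
    · rw [charpoly_coeff_of_card_lt M h, mul_zero, map_zero]
  case top => rw [charpoly_coeff_card, one_mul, hE_one]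
  case euler =>
    have integration_by_parts :
        E (∑ k, x k * d k (M.charpoly.coeff a * M.charpoly.coeff b)) =
          E (∑ k, d k (d k (M.charpoly.coeff a * M.charpoly.coeff b))) := by
      simp only [map_sum, hE]
    rw [sum_mul_derivation_charpoly_coeff_mul hx,
      sum_derivation_derivation_charpoly_coeff_mul hM hM'] at integration_by_parts
    simp only [map_sub, map_smul, smul_eq_mul] at integration_by_parts
    linear_combination integration_by_parts
  case zero => rw [trace_adjugateCoeff_mul_zero, map_sub, map_add_two_mul]
  case succ =>
    rw [trace_adjugateCoeff_mul_succ, map_add, map_sub, map_add_two_mul, map_add_two_mul, mul_add]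

end GaussianFunctional

section GaussianMoments

open scoped NNReal

variable {v : ℝ≥0}

theorem integrable_pow_gaussianReal (n : ℕ) :
    Integrable (fun x : ℝ => x ^ n) (gaussianReal 0 v) := by
  rw [← integrable_norm_iff (by fun_prop)]
  simpa only [norm_pow, id] using
    (memLp_id_gaussianReal (μ := 0) (v := v) n).integrable_norm_pow'

theorem integrable_gaussianPDFReal_mul_pow (n : ℕ) :
    Integrable (fun x : ℝ => gaussianPDFReal 0 v x * x ^ n) := by
  rcases eq_or_ne v 0 with rfl | hv
  · simp
  have h := integrable_pow_gaussianReal (v := v) n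
  rw [gaussianReal_of_var_ne_zero _ hv, integrable_withDensity_iff_integrable_smul'
    (by fun_prop) (by simp [gaussianPDF])] at h
  simpa only [toReal_gaussianPDF, smul_eq_mul] using h

theorem hasDerivAt_gaussianPDFReal (x : ℝ) :
    HasDerivAt (gaussianPDFReal 0 v) (-(x / v) * gaussianPDFReal 0 v x) x := by
  have h : HasDerivAt (fun x : ℝ => -(x - 0) ^ 2 / (2 * (v : ℝ))) (-(x / v)) x := by
    refine ((((hasDerivAt_id x).sub_const 0).pow 2).neg.div_const (2 * (v : ℝ))).congr_deriv ?_
    simp only [id, sub_zero]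
    ring
  rw [gaussianPDFReal_def]
  exact (h.exp.const_mul _).congr_deriv (by ring)

theorem integral_pow_succ_gaussianReal (n : ℕ) :
    ∫ x, x ^ (n + 1) ∂gaussianReal 0 v = v * (n * ∫ x, x ^ (n - 1) ∂gaussianReal 0 v) := by
  rcases eq_or_ne v 0 with rfl | hv
  · simp
  have hasDerivAt (x : ℝ) : HasDerivAt (fun x => gaussianPDFReal 0 v x * x ^ n)
      (n * (gaussianPDFReal 0 v x * x ^ (n - 1)) -
        (v : ℝ)⁻¹ * (gaussianPDFReal 0 v x * x ^ (n + 1))) x :=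
    ((hasDerivAt_gaussianPDFReal x).mul (hasDerivAt_pow n x)).congr_deriv (by ring)
  have integrable (c : ℝ) (m : ℕ) := (integrable_gaussianPDFReal_mul_pow (v := v) m).const_mul c
  have integral_eq_zero := integral_eq_zero_of_hasDerivAt_of_integrable hasDerivAt
    ((integrable _ _).sub (integrable _ _)) (integrable_gaussianPDFReal_mul_pow n)
  rw [integral_sub (integrable _ _) (integrable _ _), integral_const_mul, integral_const_mul,
    sub_eq_zero, eq_inv_mul_iff_mul_eq₀ (by exact_mod_cast hv)] at integral_eq_zero
  simpa only [integral_gaussianReal_eq_integral_smul hv, smul_eq_mul] using integral_eq_zero.symm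

end GaussianMoments

section GaussianPolynomials

open scoped NNReal

variable {σ 𝕜 : Type*} [Fintype σ] [RCLike 𝕜] {v : σ → ℝ≥0}

theorem integrable_prod_pow_gaussianReal (s : σ → ℕ) :
    Integrable (fun g : σ → ℝ => ∏ k, (g k : 𝕜) ^ s k)
      (Measure.pi fun k => gaussianReal 0 (v k)) :=
  Integrable.fintype_prod_dep (f := fun k (x : ℝ) => (x : 𝕜) ^ s k) fun k => by
    simpa only [RCLike.ofReal_pow] using (integrable_pow_gaussianReal (s k)).ofReal (𝕜 := 𝕜)

theorem integral_prod_pow_gaussianReal (s : σ → ℕ) :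
    ∫ g, ∏ k, (g k : 𝕜) ^ s k ∂Measure.pi (fun k => gaussianReal 0 (v k)) =
      ∏ k, ((∫ x, x ^ s k ∂gaussianReal 0 (v k) : ℝ) : 𝕜) := by
  simp only [← integral_ofReal, RCLike.ofReal_pow]
  exact integral_fintype_prod_eq_prod fun k (x : ℝ) => (x : 𝕜) ^ s k

theorem aeval_ofReal_monomial (g : σ → ℝ) (s : σ →₀ ℕ) (c : 𝕜) :
    MvPolynomial.aeval (fun k => (g k : 𝕜)) (MvPolynomial.monomial s c) =
      c * ∏ k, (g k : 𝕜) ^ s k := by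
  rw [MvPolynomial.aeval_monomial, Finsupp.prod_fintype _ _ fun _ => pow_zero _,
    Algebra.algebraMap_self_apply]

theorem integrable_aeval_gaussianReal (p : MvPolynomial σ 𝕜) :
    Integrable (fun g : σ → ℝ => MvPolynomial.aeval (fun k => (g k : 𝕜)) p)
      (Measure.pi fun k => gaussianReal 0 (v k)) := by
  induction p using MvPolynomial.induction_on' with
  | monomial s c =>
    simp only [aeval_ofReal_monomial]
    exact (integrable_prod_pow_gaussianReal s).const_mul c
  | add p q hp hq =>
    simp only [map_add]
    exact hp.add hq

variable (v) in
/-- The expectation of a polynomial in independent centred Gaussians of variances `v`, as a linear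
functional of the polynomial. -/
def gaussianExpectation : MvPolynomial σ 𝕜 →ₗ[𝕜] 𝕜 where
  toFun p := ∫ g, MvPolynomial.aeval (fun k => (g k : 𝕜)) p
    ∂Measure.pi fun k => gaussianReal 0 (v k)
  map_add' p q := by
    simp only [map_add]
    exact integral_add (integrable_aeval_gaussianReal p) (integrable_aeval_gaussianReal q)
  map_smul' c p := by
    simp only [map_smul, RingHom.id_apply]
    exact integral_smul c _

theorem gaussianExpectation_apply (p : MvPolynomial σ 𝕜) :
    gaussianExpectation v p = ∫ g, MvPolynomial.aeval (fun k => (g k : 𝕜)) p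
      ∂Measure.pi fun k => gaussianReal 0 (v k) := rfl

theorem gaussianExpectation_monomial (s : σ →₀ ℕ) (c : 𝕜) :
    gaussianExpectation v (MvPolynomial.monomial s c) =
      c * ∏ k, ((∫ x, x ^ s k ∂gaussianReal 0 (v k) : ℝ) : 𝕜) := by
  simp only [gaussianExpectation_apply, aeval_ofReal_monomial]
  rw [integral_const_mul, integral_prod_pow_gaussianReal]

theorem gaussianExpectation_one : gaussianExpectation v (1 : MvPolynomial σ 𝕜) = 1 := by
  simp [gaussianExpectation_apply]

theorem gaussianExpectation_X_mul (k : σ) (p : MvPolynomial σ 𝕜) :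
    gaussianExpectation v (MvPolynomial.X k * p) =
      (v k : ℝ) * gaussianExpectation v (MvPolynomial.pderiv k p) := by
  classical
  induction p using MvPolynomial.induction_on' with
  | monomial s c =>
    have prod_eq (t : σ →₀ ℕ) (ht : ∀ l ≠ k, t l = s l) :
        ∏ l, ((∫ x, x ^ t l ∂gaussianReal 0 (v l) : ℝ) : 𝕜) =
          ((∫ x, x ^ t k ∂gaussianReal 0 (v k) : ℝ) : 𝕜) *
            ∏ l ∈ Finset.univ.erase k, ((∫ x, x ^ s l ∂gaussianReal 0 (v l) : ℝ) : 𝕜) := by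
      rw [← Finset.mul_prod_erase _ _ (Finset.mem_univ k)]
      congr 1
      exact Finset.prod_congr rfl fun l hl => by rw [ht l (Finset.ne_of_mem_erase hl)]
    rw [MvPolynomial.X, MvPolynomial.monomial_mul, MvPolynomial.pderiv_monomial,
      gaussianExpectation_monomial, gaussianExpectation_monomial,
      prod_eq _ fun l hl => by simp [hl.symm], prod_eq _ fun l hl => by simp [hl.symm]]
    simp only [Finsupp.add_apply, Finsupp.single_eq_same, Finsupp.tsub_apply, add_comm 1,
      integral_pow_succ_gaussianReal, map_mul, map_natCast]
    ring
  | add p q hp hq => simp only [mul_add, map_add, hp, hq]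

end GaussianPolynomials

theorem pi_map_curry {ι κ X : Type*} [Fintype ι] [Fintype κ] [MeasurableSpace X]
    (μ : ι → κ → Measure X) [∀ i j, IsProbabilityMeasure (μ i j)] :
    (Measure.pi fun k : ι × κ => μ k.1 k.2).map (MeasurableEquiv.curry ι κ X) =
      Measure.pi fun i => Measure.pi (μ i) := by
  simpa only [Measure.infinitePi_eq_pi] using Measure.infinitePi_map_curry μ

section GaussianUnitaryEnsemble

variable {N : ℕ}

/-- The coefficient of `g i j` in the entry `(i, j)` of `gueMatrix N g`. -/
def gueFst (i j : Fin N) : ℂ :=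
  if i = j then ((√(N : ℝ) : ℝ) : ℂ)⁻¹
  else if i < j then ((√(2 * N : ℝ) : ℝ) : ℂ)⁻¹ else -Complex.I * ((√(2 * N : ℝ) : ℝ) : ℂ)⁻¹

/-- The coefficient of `g j i` in the entry `(i, j)` of `gueMatrix N g`, taken to be `0` on the
diagonal. -/
def gueSnd (i j : Fin N) : ℂ :=
  if i = j then 0
  else if i < j then Complex.I * ((√(2 * N : ℝ) : ℝ) : ℂ)⁻¹ else ((√(2 * N : ℝ) : ℝ) : ℂ)⁻¹

theorem sq_inv_ofReal_sqrt {x : ℝ} (hx : 0 ≤ x) : (((√x : ℝ) : ℂ)⁻¹) ^ 2 = (x : ℂ)⁻¹ := by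
  rw [inv_pow, ← Complex.ofReal_pow, Real.sq_sqrt hx]

theorem ofReal_sqrt_ne_zero (hN : N ≠ 0) : ((√(N : ℝ) : ℝ) : ℂ) ≠ 0 := by
  rw [Complex.ofReal_ne_zero]
  positivity

theorem gueFst_sq_add_gueSnd_sq (i j : Fin N) :
    gueFst i j ^ 2 + gueSnd i j ^ 2 = if i = j then (N : ℂ)⁻¹ else 0 := by
  have variance := sq_inv_ofReal_sqrt N.cast_nonneg
  rw [gueFst, gueSnd]
  split_ifs
  · linear_combination variance
  all_goals linear_combination (((√(2 * N : ℝ) : ℝ) : ℂ)⁻¹ ^ 2) * Complex.I_sq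

theorem gueFst_mul_gueSnd_add (i j : Fin N) :
    gueFst i j * gueSnd j i + gueSnd i j * gueFst j i = if i = j then 0 else (N : ℂ)⁻¹ := by
  have variance := sq_inv_ofReal_sqrt (x := 2 * N) (by positivity)
  push_cast [mul_inv] at variance
  rcases lt_trichotomy i j with hij | rfl | hij
  · simp only [gueFst, gueSnd, hij.ne, hij.ne', hij, hij.not_gt, if_true, if_false]
    linear_combination 2 * variance - (((√(2 * N : ℝ) : ℝ) : ℂ)⁻¹ ^ 2) * Complex.I_sq
  · simp [gueSnd]
  · simp only [gueFst, gueSnd, hij.ne, hij.ne', hij, hij.not_gt, if_true, if_false]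
    linear_combination 2 * variance - (((√(2 * N : ℝ) : ℝ) : ℂ)⁻¹ ^ 2) * Complex.I_sq

variable (N) in
/-- The matrix `gueMatrix N g` with its entries read as linear forms in the variables `g i j`. -/
def gueForm : Matrix (Fin N) (Fin N) (MvPolynomial (Fin N × Fin N) ℂ) :=
  Matrix.of fun i j => MvPolynomial.C (gueFst i j) * MvPolynomial.X (i, j) +
    MvPolynomial.C (gueSnd i j) * MvPolynomial.X (j, i)

theorem gueForm_apply (i j : Fin N) :
    gueForm N i j = MvPolynomial.C (gueFst i j) * MvPolynomial.X (i, j) +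
      MvPolynomial.C (gueSnd i j) * MvPolynomial.X (j, i) := rfl

theorem aeval_gueForm (g : Fin N × Fin N → ℝ) (i j : Fin N) :
    MvPolynomial.aeval (fun k => (g k : ℂ)) (gueForm N i j) = gueMatrix N g.curry i j := by
  simp only [gueForm_apply, map_add, map_mul, MvPolynomial.aeval_X, MvPolynomial.aeval_C,
    Algebra.algebraMap_self_apply, gueFst, gueSnd, gueMatrix, Matrix.of_apply, Function.curry_apply]
  split_ifs with hij
  · subst hij
    push_cast
    ring
  all_goals ring

theorem pderiv_gueForm (k : Fin N × Fin N) (i j : Fin N) :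
    MvPolynomial.pderiv k (gueForm N i j) = MvPolynomial.C
      ((if k = (i, j) then gueFst i j else 0) + if k = (j, i) then gueSnd i j else 0) := by
  simp only [gueForm_apply, map_add, MvPolynomial.pderiv_C_mul, MvPolynomial.pderiv_X,
    Pi.single_apply, eq_comm (a := k), mul_ite, mul_one, mul_zero,
    apply_ite MvPolynomial.C, map_zero]

theorem pderiv_pderiv_gueForm (k : Fin N × Fin N) (i j : Fin N) :
    MvPolynomial.pderiv k (MvPolynomial.pderiv k (gueForm N i j)) = 0 := by
  rw [pderiv_gueForm, MvPolynomial.pderiv_C]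

theorem sum_X_mul_pderiv_gueForm (i j : Fin N) :
    ∑ k, MvPolynomial.X k * MvPolynomial.pderiv k (gueForm N i j) = gueForm N i j := by
  simp only [pderiv_gueForm, map_add, apply_ite MvPolynomial.C, map_zero, mul_add, mul_ite,
    mul_zero, Finset.sum_add_distrib, Finset.sum_ite_eq', Finset.mem_univ, if_true]
  rw [gueForm_apply, mul_comm, mul_comm (MvPolynomial.X (j, i))]

theorem sum_pderiv_gueForm_mul (i j l m : Fin N) :
    ∑ k, MvPolynomial.pderiv k (gueForm N i j) * MvPolynomial.pderiv k (gueForm N l m) =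
      MvPolynomial.C ((if i = l ∧ j = m then gueFst i j ^ 2 + gueSnd i j ^ 2 else 0) +
        if i = m ∧ j = l then gueFst i j * gueSnd j i + gueSnd i j * gueFst j i else 0) := by
  simp only [pderiv_gueForm, ← map_mul, ← map_sum]
  congr 1
  simp only [add_mul, mul_add, mul_ite, ite_mul, mul_zero, zero_mul,
    Finset.sum_add_distrib, Finset.mem_univ, if_true, Finset.sum_ite_eq', Prod.mk.injEq]
  by_cases direct : i = l ∧ j = m <;> by_cases transposed : i = m ∧ j = l <;> grind

theorem hasUnitaryCovariance_gueForm :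
    HasUnitaryCovariance (fun k => (gueForm N).map (MvPolynomial.pderiv k))
      (algebraMap ℂ (MvPolynomial (Fin N × Fin N) ℂ) (N : ℂ)⁻¹) := by
  intro i j l m
  simp only [Matrix.map_apply]
  rw [sum_pderiv_gueForm_mul, gueFst_sq_add_gueSnd_sq, gueFst_mul_gueSnd_add,
    MvPolynomial.algebraMap_eq]
  by_cases hij : i = j <;> grind

theorem momentEquations_gueForm :
    MomentEquations N (N : ℂ)⁻¹
      (fun a b => gaussianExpectation (fun _ => 1)
        ((gueForm N).charpoly.coeff a * (gueForm N).charpoly.coeff b))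
      (fun a b => (N : ℂ)⁻¹ * gaussianExpectation (fun _ => 1)
        (adjugateCoeff (gueForm N) a * adjugateCoeff (gueForm N) b).trace) := by
  have integration_by_parts (k : Fin N × Fin N) (p : MvPolynomial (Fin N × Fin N) ℂ) :
      gaussianExpectation (fun _ => 1) (MvPolynomial.X k * p) =
        gaussianExpectation (fun _ => 1) (MvPolynomial.pderiv k p) := by
    rw [gaussianExpectation_X_mul, NNReal.coe_one, RCLike.ofReal_one, one_mul]
  simpa only [Fintype.card_fin] using momentEquations_charpoly_coeff gaussianExpectation_one
    integration_by_parts sum_X_mul_pderiv_gueForm hasUnitaryCovariance_gueForm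
    pderiv_pderiv_gueForm

theorem gaussianExpectation_gueForm_charpoly_coeff_mul (hN : N ≠ 0) (a b : ℕ) :
    gaussianExpectation (fun _ => 1)
        ((gueForm N).charpoly.coeff a * (gueForm N).charpoly.coeff b) =
      ((√(N : ℝ) : ℝ) : ℂ) ^ (a + b) / ((√(N : ℝ) : ℝ) : ℂ) ^ (2 * N) * hermiteKernel ℂ N a b := by
  have kernel := (momentEquations_hermiteKernel (K := ℂ) N).rescale (ofReal_sqrt_ne_zero hN)
  rw [← inv_pow, sq_inv_ofReal_sqrt N.cast_nonneg, Complex.ofReal_natCast] at kernel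
  exact congr_fun₂ (momentEquations_gueForm.unique kernel) a b

theorem gueMeasure_eq_map :
    gueMeasure N = (Measure.pi fun _ : Fin N × Fin N => gaussianReal 0 1).map
      fun g => gueMatrix N g.curry := by
  rw [gueMeasure, ← pi_map_curry (fun _ _ => gaussianReal 0 1),
    Measure.map_map (measurable_gueMatrix N) (MeasurableEquiv.measurable _)]
  rfl

theorem measurable_aeval_matrix (P : MvPolynomial (Fin N × Fin N) ℂ) :
    Measurable fun M : Matrix (Fin N) (Fin N) ℂ =>
      MvPolynomial.aeval (fun k => M k.1 k.2) P := by
  have measurable_entry (k : Fin N × Fin N) :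
      Measurable fun M : Matrix (Fin N) (Fin N) ℂ => M k.1 k.2 :=
    (measurable_pi_apply k.2).comp (measurable_pi_apply k.1)
  exact (MvPolynomial.continuous_eval P).measurable.comp (measurable_pi_lambda _ measurable_entry)

theorem aeval_gueMatrix (P : MvPolynomial (Fin N × Fin N) ℂ) (g : Fin N × Fin N → ℝ) :
    MvPolynomial.aeval (fun k => gueMatrix N g.curry k.1 k.2) P =
      MvPolynomial.aeval (fun k => (g k : ℂ))
        (MvPolynomial.aeval (fun k => gueForm N k.1 k.2) P) := by
  simp only [← aeval_gueForm]
  exact (MvPolynomial.comp_aeval_apply _ _ P).symm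

theorem measurable_gueMatrix_curry :
    Measurable fun g : Fin N × Fin N → ℝ => gueMatrix N g.curry :=
  (measurable_gueMatrix N).comp (MeasurableEquiv.curry (Fin N) (Fin N) ℝ).measurable

theorem integrable_aeval_gueMeasure (P : MvPolynomial (Fin N × Fin N) ℂ) :
    Integrable (fun M => MvPolynomial.aeval (fun k => M k.1 k.2) P) (gueMeasure N) := by
  rw [gueMeasure_eq_map, integrable_map_measure (measurable_aeval_matrix P).aestronglyMeasurable
    measurable_gueMatrix_curry.aemeasurable]
  simp only [Function.comp_def, aeval_gueMatrix]
  exact integrable_aeval_gaussianReal _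

theorem integral_aeval_gueMeasure (P : MvPolynomial (Fin N × Fin N) ℂ) :
    ∫ M, MvPolynomial.aeval (fun k => M k.1 k.2) P ∂gueMeasure N =
      gaussianExpectation (fun _ => 1) (MvPolynomial.aeval (fun k => gueForm N k.1 k.2) P) := by
  rw [gueMeasure_eq_map, integral_map measurable_gueMatrix_curry.aemeasurable
    (measurable_aeval_matrix P).aestronglyMeasurable]
  simp only [aeval_gueMatrix]
  rfl

theorem aeval_charpoly_univ_coeff {n R A : Type*} [Fintype n] [DecidableEq n] [CommRing R]
    [CommRing A] [Algebra R A] (M : Matrix n n A) (a : ℕ) :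
    MvPolynomial.aeval (fun k => M k.1 k.2) ((Matrix.charpoly.univ R n).coeff a) =
      M.charpoly.coeff a :=
  Matrix.charpoly.univ_coeff_eval₂Hom n (algebraMap R A) (fun k => M k.1 k.2) a

theorem integrable_charpoly_coeff_mul (a b : ℕ) :
    Integrable (fun M => M.charpoly.coeff a * M.charpoly.coeff b) (gueMeasure N) := by
  simpa only [map_mul, aeval_charpoly_univ_coeff] using
    integrable_aeval_gueMeasure ((Matrix.charpoly.univ ℂ (Fin N)).coeff a *
      (Matrix.charpoly.univ ℂ (Fin N)).coeff b)

theorem integral_charpoly_coeff_mul (hN : N ≠ 0) (a b : ℕ) :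
    ∫ M, M.charpoly.coeff a * M.charpoly.coeff b ∂gueMeasure N =
      ((√(N : ℝ) : ℝ) : ℂ) ^ (a + b) / ((√(N : ℝ) : ℝ) : ℂ) ^ (2 * N) * hermiteKernel ℂ N a b := by
  have integral_eq := integral_aeval_gueMeasure ((Matrix.charpoly.univ ℂ (Fin N)).coeff a *
    (Matrix.charpoly.univ ℂ (Fin N)).coeff b)
  simp only [map_mul, aeval_charpoly_univ_coeff] at integral_eq
  rw [integral_eq, gaussianExpectation_gueForm_charpoly_coeff_mul hN]

end GaussianUnitaryEnsemble

section SecularCoefficients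

variable {N : ℕ}

theorem secular_of_lt {r : ℕ} (hr : N < r) (M : Matrix (Fin N) (Fin N) ℂ) : secular r M = 0 :=
  if_neg hr.not_ge

theorem secular_of_le {r : ℕ} (hr : r ≤ N) (M : Matrix (Fin N) (Fin N) ℂ) :
    secular r M = (-1) ^ r * M.charpoly.coeff (N - r) :=
  if_pos hr

theorem secular_zero (M : Matrix (Fin N) (Fin N) ℂ) : secular 0 M = 1 := by
  have coeff_eq_one := charpoly_coeff_card M
  rw [Fintype.card_fin] at coeff_eq_one
  rw [secular_of_le N.zero_le, pow_zero, one_mul, Nat.sub_zero, coeff_eq_one]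

theorem secular_mul_secular {r s : ℕ} (hr : r ≤ N) (hs : s ≤ N) (M : Matrix (Fin N) (Fin N) ℂ) :
    secular r M * secular s M =
      (-1) ^ (r + s) * (M.charpoly.coeff (N - r) * M.charpoly.coeff (N - s)) := by
  rw [secular_of_le hr, secular_of_le hs, mul_mul_mul_comm, pow_add]

theorem integrable_secular_mul_secular (r s : ℕ) :
    Integrable (fun M : Matrix (Fin N) (Fin N) ℂ => secular r M * secular s M) (gueMeasure N) := by
  by_cases hrs : r ≤ N ∧ s ≤ N
  · simp only [secular_mul_secular hrs.1 hrs.2]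
    exact (integrable_charpoly_coeff_mul _ _).const_mul _
  · rcases not_and_or.mp hrs with h | h <;> simp [secular_of_lt (not_le.mp h)]

theorem integrable_secular (r : ℕ) :
    Integrable (fun M : Matrix (Fin N) (Fin N) ℂ => secular r M) (gueMeasure N) := by
  simpa only [secular_zero, mul_one] using integrable_secular_mul_secular (N := N) r 0

theorem integral_secular_mul_secular {r s : ℕ} (hN : N ≠ 0) (hr : r ≤ N) (hs : s ≤ N) :
    ∫ M : Matrix (Fin N) (Fin N) ℂ, secular r M * secular s M ∂gueMeasure N =
      (-((√(N : ℝ) : ℝ) : ℂ)⁻¹) ^ (r + s) * hermiteKernel ℂ N (N - r) (N - s) := by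
  simp only [secular_mul_secular hr hs]
  rw [integral_const_mul, integral_charpoly_coeff_mul hN,
    show 2 * N = N - r + (N - s) + (r + s) by omega, pow_add _ _ (r + s),
    div_mul_cancel_left₀ (pow_ne_zero _ (ofReal_sqrt_ne_zero hN)), neg_pow _⁻¹, inv_pow, mul_assoc]

theorem integral_secular {r : ℕ} (hN : N ≠ 0) (hr : r ≤ N) :
    ∫ M : Matrix (Fin N) (Fin N) ℂ, secular r M ∂gueMeasure N =
      (-((√(N : ℝ) : ℝ) : ℂ)⁻¹) ^ r * hermiteCoeff ℂ N (N - r) := by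
  simpa only [secular_zero, mul_one, add_zero, Nat.sub_zero, hermiteKernel_self_right] using
    integral_secular_mul_secular hN hr N.zero_le

theorem integral_secular_mul_secular_of_odd {r s : ℕ} (hN : N ≠ 0) (hrs : Odd (r + s)) :
    ∫ M : Matrix (Fin N) (Fin N) ℂ, secular r M * secular s M ∂gueMeasure N = 0 := by
  by_cases hle : r ≤ N ∧ s ≤ N
  · rw [integral_secular_mul_secular hN hle.1 hle.2, hermiteKernel_of_odd (by grind), mul_zero]
  · rcases not_and_or.mp hle with h | h <;> simp [secular_of_lt (not_le.mp h)]

theorem integral_secular_of_odd {r : ℕ} (hN : N ≠ 0) (hr : Odd r) :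
    ∫ M : Matrix (Fin N) (Fin N) ℂ, secular r M ∂gueMeasure N = 0 := by
  simpa only [secular_zero, mul_one] using integral_secular_mul_secular_of_odd (s := 0) hN hr

theorem neg_inv_sqrt_pow_two_mul (N m : ℕ) :
    (-((√(N : ℝ) : ℝ) : ℂ)⁻¹) ^ (2 * m) = (N : ℂ)⁻¹ ^ m := by
  rw [pow_mul, neg_sq, sq_inv_ofReal_sqrt N.cast_nonneg, Complex.ofReal_natCast]

theorem inv_pow_mul_neg_half_pow (N m : ℕ) :
    (N : ℂ)⁻¹ ^ m * (-(1 / 2)) ^ m = (-(1 / (2 * N))) ^ m := by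
  rw [← mul_pow, mul_neg, inv_mul_eq_div, div_div]

theorem integral_secular_two_mul {r : ℕ} (hN : N ≠ 0) (hr : 2 * r ≤ N) :
    ∫ M : Matrix (Fin N) (Fin N) ℂ, secular (2 * r) M ∂gueMeasure N =
      (-1) ^ r * (N.factorial / ((2 * N) ^ r * r.factorial * (N - 2 * r).factorial)) := by
  have hermiteCoeff_eq := hermiteCoeff_two_mul_add (K := ℂ) r (N - 2 * r)
  rw [Nat.add_sub_cancel' hr] at hermiteCoeff_eq
  rw [integral_secular hN hr, neg_inv_sqrt_pow_two_mul, hermiteCoeff_eq, ← mul_assoc,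
    inv_pow_mul_neg_half_pow, neg_pow, mul_assoc, div_pow, one_pow, div_mul_div_comm, one_mul,
    mul_assoc (_ ^ r)]

theorem integral_secular_two_mul_mul_secular_two_mul {r s : ℕ} (hN : N ≠ 0) (hr : 2 * r ≤ N)
    (hs : 2 * s ≤ N) :
    ∫ M : Matrix (Fin N) (Fin N) ℂ, secular (2 * r) M * secular (2 * s) M ∂gueMeasure N =
      (-(1 / (2 * N))) ^ (r + s) * ∑ j ∈ Finset.range (min r s + 1),
        (2 : ℂ) ^ (2 * j) / (((r - j).factorial : ℂ) * (s - j).factorial) *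
          (((N.factorial : ℂ) * (N - 2 * j).factorial) /
            (((N - 2 * r).factorial : ℂ) * (N - 2 * s).factorial)) := by
  rw [integral_secular_mul_secular hN hr hs, ← mul_add, neg_inv_sqrt_pow_two_mul,
    hermiteKernel_sub_sub hr hs, ← mul_assoc, inv_pow_mul_neg_half_pow]

theorem integral_secular_odd_mul_secular_odd {r s : ℕ} (hr : 2 * r ≤ N) (hs : 2 * s ≤ N) :
    ∫ M : Matrix (Fin (N + 1)) (Fin (N + 1)) ℂ,
        secular (2 * r + 1) M * secular (2 * s + 1) M ∂gueMeasure (N + 1) =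
      (-(1 / (2 * (N + 1 : ℕ)))) ^ (r + s) * ∑ j ∈ Finset.range (min r s + 1),
        (2 : ℂ) ^ (2 * j) / (((r - j).factorial : ℂ) * (s - j).factorial) *
          (((N.factorial : ℂ) * (N - 2 * j).factorial) /
            (((N - 2 * r).factorial : ℂ) * (N - 2 * s).factorial)) := by
  have cast_ne_zero : ((N + 1 : ℕ) : ℂ) ≠ 0 := Nat.cast_ne_zero.mpr N.add_one_ne_zero
  rw [integral_secular_mul_secular N.add_one_ne_zero (by omega) (by omega), Nat.add_sub_add_right,
    Nat.add_sub_add_right, hermiteKernel_succ_sub_sub hr, hermiteKernel_sub_sub hr hs,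
    show 2 * r + 1 + (2 * s + 1) = 2 * (r + s + 1) by ring, neg_inv_sqrt_pow_two_mul, pow_succ,
    ← Nat.cast_add_one, mul_assoc, inv_mul_cancel_left₀ cast_ne_zero,
    ← mul_assoc, inv_pow_mul_neg_half_pow]

section CharacteristicPolynomial

variable (N) (t : ℂ)

theorem integrable_det_sub :
    Integrable (fun M => (Matrix.scalar (Fin N) t - M).det) (gueMeasure N) := by
  simp only [det_sub_eq_sum_secular]
  exact integrable_finsetSum _ fun j _ => ((integrable_secular j).const_mul _).mul_const _

theorem integral_det_sub :
    ∫ M, (Matrix.scalar (Fin N) t - M).det ∂gueMeasure N =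
      ∑ j ∈ Finset.range (N + 1),
        (-1) ^ j * (∫ M : Matrix (Fin N) (Fin N) ℂ, secular j M ∂gueMeasure N) * t ^ (N - j) := by
  simp only [det_sub_eq_sum_secular]
  rw [integral_finsetSum _ fun j _ => ((integrable_secular j).const_mul _).mul_const _]
  simp only [integral_mul_const, integral_const_mul]

theorem integral_det_sub_eq_sum_even (hN : N ≠ 0) :
    ∫ M, (Matrix.scalar (Fin N) t - M).det ∂gueMeasure N =
      ∑ j ∈ Finset.range (N / 2 + 1),
        (∫ M : Matrix (Fin N) (Fin N) ℂ, secular (2 * j) M ∂gueMeasure N) * t ^ (N - 2 * j) := by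
  rw [integral_det_sub, sum_range_succ_eq_sum_range_half fun j _ hj => by
    rw [integral_secular_of_odd hN hj, mul_zero, zero_mul]]
  simp only [pow_mul, neg_one_sq, one_pow, one_mul]

theorem scaledHermite_self_eq_sum (hN : N ≠ 0) :
    scaledHermite N N t = ∑ j ∈ Finset.range (N + 1),
      ((√(N : ℝ) : ℝ) : ℂ)⁻¹ ^ j * hermiteCoeff ℂ N (N - j) * t ^ (N - j) := by
  rw [scaledHermite, aeval_eq_sum_range, natDegree_hermite, ← Finset.sum_range_reflect,
    Finset.mul_sum]
  refine Finset.sum_congr rfl fun j hj => ?_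
  have sqrt_ne_zero := ofReal_sqrt_ne_zero hN
  have sqrt_pow := pow_mul_pow_sub ((√(N : ℝ) : ℝ) : ℂ) (Finset.mem_range_succ_iff.mp hj)
  rw [Nat.add_sub_cancel, zsmul_eq_mul, mul_pow, hermiteCoeff, inv_pow, ← sqrt_pow]
  field_simp

theorem integral_det_sub_eq_scaledHermite (hN : N ≠ 0) :
    ∫ M, (Matrix.scalar (Fin N) t - M).det ∂gueMeasure N = scaledHermite N N t := by
  rw [integral_det_sub, scaledHermite_self_eq_sum N t hN]
  refine Finset.sum_congr rfl fun j hj => ?_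
  rw [integral_secular hN (Finset.mem_range_succ_iff.mp hj), ← mul_assoc, ← mul_pow, neg_one_mul,
    neg_neg]

end CharacteristicPolynomial

end SecularCoefficients

end

end

theorem mainTheorem5 (N : ℕ) (hN : 1 ≤ N) :
    -- all first and second moments exist
    (∀ r : ℕ, Integrable (fun M => secular r M) (gueMeasure N)) ∧
    (∀ r s : ℕ, Integrable (fun M => secular r M * secular s M) (gueMeasure N)) ∧
    -- first moments
    (∀ r : ℕ, Odd r → ∫ M, secular r M ∂(gueMeasure N) = 0) ∧
    (∀ r : ℕ, Even r → r ≤ N →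
      ∫ M, secular r M ∂(gueMeasure N) =
        (-1) ^ (r / 2) * ((N.factorial : ℂ) /
          ((2 * (N : ℂ)) ^ (r / 2) * ((r / 2).factorial : ℂ) * ((N - r).factorial : ℂ)))) ∧
    -- expected characteristic polynomial
    (∀ t : ℂ, Integrable (fun M => (Matrix.scalar (Fin N) t - M).det) (gueMeasure N) ∧
      ∫ M, (Matrix.scalar (Fin N) t - M).det ∂(gueMeasure N) =
        ∑ j ∈ Finset.range (N / 2 + 1),
          (∫ M, secular (2 * j) M ∂(gueMeasure N)) * t ^ (N - 2 * j) ∧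
      ∫ M, (Matrix.scalar (Fin N) t - M).det ∂(gueMeasure N) = scaledHermite N N t) ∧
    -- mixed even-odd second moments
    (∀ j k : ℕ, ∫ M, secular (2 * j) M * secular (2 * k + 1) M ∂(gueMeasure N) = 0) ∧
    -- even-even second moments
    (∀ r s : ℕ, 2 * r ≤ N → 2 * s ≤ N →
      ∫ M, secular (2 * r) M * secular (2 * s) M ∂(gueMeasure N) =
        (-(1 / (2 * (N : ℂ)))) ^ (r + s) *
          ∑ j ∈ Finset.range (min r s + 1),
            (2 : ℂ) ^ (2 * j) / (((r - j).factorial : ℂ) * ((s - j).factorial : ℂ)) *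
              (((N.factorial : ℂ) * ((N - 2 * j).factorial : ℂ)) /
                (((N - 2 * r).factorial : ℂ) * ((N - 2 * s).factorial : ℂ)))) ∧
    -- odd-odd second moments
    (∀ r s : ℕ, 2 * r + 1 ≤ N → 2 * s + 1 ≤ N →
      ∫ M, secular (2 * r + 1) M * secular (2 * s + 1) M ∂(gueMeasure N) =
        (-(1 / (2 * (N : ℂ)))) ^ (r + s) *
          ∑ j ∈ Finset.range (min r s + 1),
            (2 : ℂ) ^ (2 * j) / (((r - j).factorial : ℂ) * ((s - j).factorial : ℂ)) *
              ((((N - 1).factorial : ℂ) * ((N - 2 * j - 1).factorial : ℂ)) /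
                (((N - 2 * r - 1).factorial : ℂ) * ((N - 2 * s - 1).factorial : ℂ)))) := by
  have hN₀ : N ≠ 0 := Nat.one_le_iff_ne_zero.mp hN
  refine ⟨integrable_secular, integrable_secular_mul_secular, fun _ => integral_secular_of_odd hN₀,
    ?even, fun t => ⟨integrable_det_sub N t, integral_det_sub_eq_sum_even N t hN₀,
      integral_det_sub_eq_scaledHermite N t hN₀⟩,
    fun j k => integral_secular_mul_secular_of_odd hN₀ (by grind),
    fun _ _ => integral_secular_two_mul_mul_secular_two_mul hN₀, ?odd_odd⟩
  case even =>
    intro r hr hrN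
    obtain ⟨m, rfl⟩ := even_iff_two_dvd.mp hr
    rw [Nat.mul_div_cancel_left m two_pos]
    exact integral_secular_two_mul hN₀ hrN
  case odd_odd =>
    obtain ⟨n, rfl⟩ := Nat.exists_eq_add_of_le' hN
    intro r s hr hs
    simp only [Nat.sub_right_comm _ _ 1, Nat.add_sub_cancel]
    exact integral_secular_odd_mul_secular_odd (by omega) (by omega)
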